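/- Let $N$ (players) and $R$ (resources) be finite sets. For each player $i \in N$ let $f^{(i)} : 2^R \to \mathbb{N}$ be an integral polymatroid rank function, i.e. $f^{(i)}(\emptyset)=0$, $f^{(i)}(U) \le f^{(i)}(V)$ whenever $U \subseteq V \subseteq R$, and $f^{(i)}(U\cup V)+f^{(i)}(U\cap V)\le f^{(i)}(U)+f^{(i)}(V)$ for all $U,V\subseteq R$; let $d_i \in \mathbb{N}$ be a demand with $d_i \le f^{(i)}(R)$; and for each $r \in R$ let $c_{i,r} : \mathbb{N} \to \mathbb{R}$ be a cost function (in particular, integer-valued cost functions are allowed). In the associated congestion game on integral polymatroids, the strategy set of player $i$ is the integral polymatroid base polyhedron $$X_i = \Bigl\{ x_i \in \mathbb{N}^R \;\Big|\; \sum_{r \in U} x_{i,r} \le f^{(i)}(U) \text{ for all } U \subseteq R,\ \sum_{r\in R} x_{i,r} = d_i \Bigr\},$$ and the private cost of player $i$ under a strategy profile $x = (x_j)_{j\in N} \in \prod_{j \in N} X_j$ is $\pi_i(x) = \sum_{r\in R} c_{i,r}(x_r)\, x_{i,r}$, where $x_r = \sum_{j \in N} x_{j,r}$. Assume that for all $i\in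 N$ and $r\in R$ the function $c_{i,r}$ is nonnegative, nondecreasing and $u_{i,r}$-truncated strongly semi-convex with $u_{i,r} = f^{(i)}(\{r\})$, i.e. $$c_{i,r}(a+x)\,x - c_{i,r}(a+x-1)\,(x-1) \;\le\; c_{i,r}(b+y)\,y - c_{i,r}(b+y-1)\,(y-1)$$ for all integers $1\le x\le y\le u_{i,r}$ and $0 \le a\le b$. (This holds in particular if every $c_{i,r}$ is strongly semi-convex, i.e. satisfies the inequality for all integers $1\le x\le y$ and $0\le a\le b$.) Then the game has a pure Nash equilibrium: there is a strategy profile $x \in \prod_{j\in N} X_j$ such that $\pi_i(x) \le \pi_i(y_i, x_{-i})$ for every player $i\in N$ and every $y_i\in X_i$. -/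

import Mathlib

open scoped BigOperators

/-- `f : 2^R → ℕ` is an integral polymatroid rank function: normalized, monotone, submodular. -/
structure IsPolymatroidRank {R : Type*} [DecidableEq R] (f : Finset R → ℕ) : Prop where
  normalized : f ∅ = 0
  monotone : ∀ U V : Finset R, U ⊆ V → f U ≤ f V
  submodular : ∀ U V : Finset R, f (U ∪ V) + f (U ∩ V) ≤ f U + f V

/-- The integral polyhedron `P_f`. -/
def integralPolyhedron {R : Type*} (f : Finset R → ℕ) : Set (R → ℕ) :=
  {x | ∀ U : Finset R, ∑ r ∈ U, x r ≤ f U}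

/-- The `d`-truncated integral polymatroid `P_f(d)`. -/
def truncatedPolymatroid {R : Type*} [Fintype R] (f : Finset R → ℕ) (d : ℕ) : Set (R → ℕ) :=
  {x | x ∈ integralPolyhedron f ∧ ∑ r, x r ≤ d}

/-- The integral polymatroid base polyhedron `B_f(d)`. -/
def basePolyhedron {R : Type*} [Fintype R] (f : Finset R → ℕ) (d : ℕ) : Set (R → ℕ) :=
  {x | x ∈ integralPolyhedron f ∧ ∑ r, x r = d}

theorem basePolyhedron_subset_truncatedPolymatroid {R : Type*} [Fintype R]
    (f : Finset R → ℕ) (d : ℕ) : basePolyhedron f d ⊆ truncatedPolymatroid f d :=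
  fun _ hx => ⟨hx.1, hx.2.le⟩

/-- Strong semi-convexity:
`c(a+x) x - c(a+x-1) (x-1) ≤ c(b+y) y - c(b+y-1) (y-1)` for all `1 ≤ x ≤ y` and `a ≤ b`.
The subtractions inside the arguments of `c` are never truncated, since `1 ≤ x` and `1 ≤ y`. -/
def StronglySemiConvex (c : ℕ → ℝ) : Prop :=
  ∀ x y a b : ℕ, 1 ≤ x → x ≤ y → a ≤ b →
    c (a + x) * (x : ℝ) - c (a + x - 1) * ((x : ℝ) - 1)
      ≤ c (b + y) * (y : ℝ) - c (b + y - 1) * ((y : ℝ) - 1)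

/-- `u`-truncated strong semi-convexity: the inequality is only required for `1 ≤ x ≤ y ≤ u`. -/
def TruncatedStronglySemiConvex (u : ℕ) (c : ℕ → ℝ) : Prop :=
  ∀ x y a b : ℕ, 1 ≤ x → x ≤ y → y ≤ u → a ≤ b →
    c (a + x) * (x : ℝ) - c (a + x - 1) * ((x : ℝ) - 1)
      ≤ c (b + y) * (y : ℝ) - c (b + y - 1) * ((y : ℝ) - 1)

theorem StronglySemiConvex.truncated {c : ℕ → ℝ} (h : StronglySemiConvex c) (u : ℕ) :
    TruncatedStronglySemiConvex u c :=
  fun x y a b hx hxy _ hab => h x y a b hx hxy hab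

/-- A congestion game on integral polymatroids with players `N` and resources `R`: every player `i`
has a demand `d_i`, an integral polymatroid rank function `f^(i)` with `d_i ≤ f^(i)(R)`, and a cost
function `c_{i,r}` for each resource `r`. -/
structure PolymatroidCongestionGame (N R : Type*) [Fintype R] [DecidableEq R] where
  demand : N → ℕ
  rank : N → Finset R → ℕ
  cost : N → R → ℕ → ℝ
  isPolymatroidRank : ∀ i, IsPolymatroidRank (rank i)
  demand_le : ∀ i, demand i ≤ rank i Finset.univ

namespace PolymatroidCongestionGame

variable {N R : Type*} [Fintype N] [DecidableEq N] [Fintype R] [DecidableEq R]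

/-- The strategy set `X_i = B_{f^(i)}(d_i)`. -/
def strategies (G : PolymatroidCongestionGame N R) (i : N) : Set (R → ℕ) :=
  basePolyhedron (G.rank i) (G.demand i)

/-- The total load `x_r = ∑ i, x_{i,r}`. -/
def load (x : N → R → ℕ) (r : R) : ℕ := ∑ i, x i r

/-- The private cost `π_i(x) = ∑ r, c_{i,r}(x_r) x_{i,r}`. -/
noncomputable def privateCost (G : PolymatroidCongestionGame N R) (i : N) (x : N → R → ℕ) : ℝ :=
  ∑ r, G.cost i r (load x r) * (x i r : ℝ)

/-- `z` is a best response of player `i` to `x_{-i}` (the row `x i` is overwritten everywhere,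
so it plays no role). -/
def IsBestResponse (G : PolymatroidCongestionGame N R) (i : N) (x : N → R → ℕ)
    (z : R → ℕ) : Prop :=
  z ∈ G.strategies i ∧ ∀ y ∈ G.strategies i,
    G.privateCost i (Function.update x i z) ≤ G.privateCost i (Function.update x i y)

/-- A pure Nash equilibrium: a strategy profile in which every player's strategy is a best
response to the strategies of the others. -/
def IsPureNashEquilibrium (G : PolymatroidCongestionGame N R) (x : N → R → ℕ) : Prop :=
  (∀ i, x i ∈ G.strategies i) ∧ ∀ i, G.IsBestResponse i x (x i)

end PolymatroidCongestionGame

/-! With the opponents fixed, a private cost is separable and convex up to the capacities, on an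
M-convex set. Hence a strategy with no profitable single-unit move is a best response
(`sum_le_sum_of_exchange`).

A profile stable under unit moves is found by induction on the total demand. Marginal costs are
monotone in the total load and in the own amount (`marginalCost_mono`). So placing one new unit on
its cheapest feasible resource keeps every player stable with respect to the old load `l`
(`ExchangeStable.add_unit`), while the true load exceeds `l` by one unit on a single resource `t`. A
profitable move at the true load must take a unit off `t`. Sent to its cheapest feasible target,
that unit carries the excess along, and stability at `l` survives (`ExchangeStable.exchange`). Each
such move strictly lowers a potential on a finite set, so the process stops. -/

namespace PolymatroidCongestionGame

/-! ### Moving a single unit -/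

section Exchange

variable {R : Type*} [DecidableEq R]

/-- The vector `x` with one unit moved from `p` to `q` (meaningful if `p ≠ q` and `1 ≤ x p`). -/
def exchange (x : R → ℕ) (p q : R) : R → ℕ :=
  fun r => if r = q then x r + 1 else if r = p then x r - 1 else x r

theorem sum_exchange [Fintype R] (F : R → ℕ → ℝ) (x : R → ℕ) {p q : R} (hpq : p ≠ q) :
    ∑ r, F r (exchange x p q r) =
      ∑ r, F r (x r) + (F q (x q + 1) - F q (x q)) - (F p (x p) - F p (x p - 1)) := by
  have h : ∀ r, F r (exchange x p q r) = F r (x r)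
      + (if r = q then F q (x q + 1) - F q (x q) else 0)
      - (if r = p then F p (x p) - F p (x p - 1) else 0) := by
    intro r
    unfold exchange
    by_cases hq : r = q
    · subst hq
      simp [hpq.symm]
    · by_cases hp : r = p
      · subst hp
        simp [hq]
      · simp [hp, hq]
  simp [h, Finset.sum_add_distrib, Finset.sum_sub_distrib]

theorem sum_finset_exchange (x : R → ℕ) {p q : R} (hpq : p ≠ q) (hp : 1 ≤ x p) (U : Finset R) :
    ∑ r ∈ U, exchange x p q r + (if p ∈ U then 1 else 0) =
      ∑ r ∈ U, x r + (if q ∈ U then 1 else 0) := by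
  have h : ∀ r, exchange x p q r + (if r = p then 1 else 0) = x r + (if r = q then 1 else 0) := by
    intro r
    unfold exchange
    grind
  have := Finset.sum_congr (rfl : U = U) fun r _ => h r
  simpa [Finset.sum_add_distrib] using this

theorem sum_univ_exchange [Fintype R] (x : R → ℕ) {p q : R} (hpq : p ≠ q) (hp : 1 ≤ x p) :
    ∑ r, exchange x p q r = ∑ r, x r := by
  simpa using sum_finset_exchange x hpq hp Finset.univ

end Exchange

/-! ### Tight sets and the exchange property -/

section Polyhedron

variable {R : Type*} {f : Finset R → ℕ}

theorem apply_le_rank_singleton {x : R → ℕ} (hx : x ∈ integralPolyhedron f) (r : R) :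
    x r ≤ f {r} := by
  simpa using hx {r}

theorem mem_integralPolyhedron_of_le {x y : R → ℕ} (hy : y ∈ integralPolyhedron f)
    (h : ∀ r, x r ≤ y r) : x ∈ integralPolyhedron f :=
  fun U => (Finset.sum_le_sum fun r _ => h r).trans (hy U)

/-- Capping `f` at `d` makes the full set tight for every base vector when `d ≤ f univ`, as
`exists_exchange_aux` requires. -/
theorem mem_basePolyhedron_min [Fintype R] {d : ℕ} {x : R → ℕ} :
    x ∈ basePolyhedron f d ↔
      x ∈ integralPolyhedron (fun U => min (f U) d) ∧ ∑ r, x r = d := by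
  refine ⟨fun h => ⟨fun U => le_min (h.1 U) ?_, h.2⟩,
    fun h => ⟨fun U => (h.1 U).trans (min_le_left _ _), h.2⟩⟩
  rw [← h.2]
  exact Finset.sum_le_sum_of_subset (Finset.subset_univ U)

variable [DecidableEq R]

theorem isPolymatroidRank_min (hf : IsPolymatroidRank f) (d : ℕ) :
    IsPolymatroidRank fun U => min (f U) d where
  normalized := by simp [hf.normalized]
  monotone U V h := min_le_min_right _ (hf.monotone U V h)
  submodular U V := by
    have h := hf.submodular U V
    have h1 := hf.monotone _ _ (Finset.subset_union_left (s₁ := U) (s₂ := V))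
    have h2 := hf.monotone _ _ (Finset.subset_union_right (s₁ := U) (s₂ := V))
    have h3 := hf.monotone _ _ (Finset.inter_subset_left (s₁ := U) (s₂ := V))
    have h4 := hf.monotone _ _ (Finset.inter_subset_right (s₁ := U) (s₂ := V))
    omega

theorem tight_union_inter (hf : IsPolymatroidRank f) {x : R → ℕ} (hx : x ∈ integralPolyhedron f)
    {U V : Finset R} (hU : ∑ r ∈ U, x r = f U) (hV : ∑ r ∈ V, x r = f V) :
    ∑ r ∈ U ∪ V, x r = f (U ∪ V) ∧ ∑ r ∈ U ∩ V, x r = f (U ∩ V) := by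
  have h := hf.submodular U V
  have h1 := hx (U ∪ V)
  have h2 := hx (U ∩ V)
  have h3 := Finset.sum_union_inter (s₁ := U) (s₂ := V) (f := x)
  omega

/-- By submodularity, tight sets are closed under union, so tight sets around the points of `A` can
be merged. -/
theorem exists_tight_superset (hf : IsPolymatroidRank f) {x : R → ℕ}
    (hx : x ∈ integralPolyhedron f) (P : Finset R → Prop) (h0 : P ∅)
    (hP : ∀ U V, P U → P V → P (U ∪ V)) (A : Finset R)
    (hA : ∀ a ∈ A, ∃ U, a ∈ U ∧ P U ∧ ∑ r ∈ U, x r = f U) :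
    ∃ U, A ⊆ U ∧ P U ∧ ∑ r ∈ U, x r = f U := by
  induction A using Finset.induction_on with
  | empty => exact ⟨∅, by simp, h0, by simp [hf.normalized]⟩
  | insert a A _ ih =>
    obtain ⟨U, hAU, hPU, hU⟩ := ih fun b hb => hA b (Finset.mem_insert_of_mem hb)
    obtain ⟨V, haV, hPV, hV⟩ := hA a (Finset.mem_insert_self a A)
    refine ⟨V ∪ U, ?_, hP V U hPV hPU, (tight_union_inter hf hx hV hU).1⟩
    exact Finset.insert_subset (Finset.mem_union_left _ haV)
      (hAU.trans Finset.subset_union_right)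

/-- A minimal tight set containing `p` is contained in all of them. -/
theorem exists_least_tight (hf : IsPolymatroidRank f) {x : R → ℕ}
    (hx : x ∈ integralPolyhedron f) (p : R) (h : ∃ U, p ∈ U ∧ ∑ r ∈ U, x r = f U) :
    ∃ D, (p ∈ D ∧ ∑ r ∈ D, x r = f D) ∧ ∀ U, p ∈ U → ∑ r ∈ U, x r = f U → D ⊆ U := by
  obtain ⟨D, hD, hmin⟩ := WellFounded.has_min
    (measure (Finset.card : Finset R → ℕ)).wf {U | p ∈ U ∧ ∑ r ∈ U, x r = f U} h
  refine ⟨D, hD, fun U hpU hU => ?_⟩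
  have h1 := hmin (D ∩ U) ⟨Finset.mem_inter.2 ⟨hD.1, hpU⟩, (tight_union_inter hf hx hD.2 hU).2⟩
  have h2 : ¬ (D ∩ U).card < D.card := h1
  exact Finset.inter_eq_left.1
    (Finset.eq_of_subset_of_card_le Finset.inter_subset_left (not_lt.1 h2))

theorem exists_tight_of_exchange_notMem {x : R → ℕ} (hx : x ∈ integralPolyhedron f) {p q : R}
    (hpq : p ≠ q) (hp : 1 ≤ x p) (h : exchange x p q ∉ integralPolyhedron f) :
    ∃ U, q ∈ U ∧ p ∉ U ∧ ∑ r ∈ U, x r = f U := by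
  simp only [integralPolyhedron, Set.mem_ofPred_eq, not_forall, not_le] at h
  obtain ⟨U, hU⟩ := h
  have h1 := sum_finset_exchange x hpq hp U
  have h2 := hx U
  refine ⟨U, ?_⟩
  split_ifs at h1 <;> simp_all <;> omega

variable [Fintype R]

/-- Let `D` be the least `y`-tight set containing `p`. For `q ∈ D`, minimality makes `y - q + p`
feasible. If the exchange always fails, every `q ∈ D` with `x q < y q` therefore lies in an
`x`-tight set avoiding `p`; let `U` be a union of such sets. Uncrossing `U` and `D` contradicts
submodularity. -/
theorem exists_exchange_aux (hf : IsPolymatroidRank f) {x y : R → ℕ}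
    (hx : x ∈ integralPolyhedron f) (hy : y ∈ integralPolyhedron f)
    (hyf : ∑ r, y r = f Finset.univ) {p : R} (hp : y p < x p) :
    ∃ q, x q < y q ∧ exchange x p q ∈ integralPolyhedron f ∧
      exchange y q p ∈ integralPolyhedron f := by
  obtain ⟨D, ⟨hpD, hD⟩, hmin⟩ := exists_least_tight hf hy p ⟨Finset.univ, by simp, hyf⟩
  by_contra! hcon
  obtain ⟨U, hAU, hpU, hU⟩ := exists_tight_superset hf hx (fun U => p ∉ U) (by simp)
    (fun U V h1 h2 => by simp [h1, h2]) (D.filter fun q => x q < y q) (by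
      intro q hq
      obtain ⟨hqD, hq⟩ := Finset.mem_filter.1 hq
      have hpq : p ≠ q := by rintro rfl; omega
      by_contra! hno
      refine hcon q hq ?_ ?_
      · by_contra hnot
        obtain ⟨U, h1, h2, h3⟩ := exists_tight_of_exchange_notMem hx hpq (by omega) hnot
        exact hno U h1 h2 h3
      · by_contra hnot
        obtain ⟨U, h1, h2, h3⟩ := exists_tight_of_exchange_notMem hy hpq.symm (by omega) hnot
        exact h2 (hmin U h1 h3 hqD))
  have h1 := hf.submodular U D
  have h2 := hx (U ∪ D)
  have h3 := hy (U ∩ D)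
  have h4 : ∑ r ∈ U ∪ D, x r = ∑ r ∈ U, x r + ∑ r ∈ D \ U, x r := by
    rw [← Finset.union_sdiff_self_eq_union, Finset.sum_union Finset.disjoint_sdiff]
  have h5 : ∑ r ∈ D, y r = ∑ r ∈ U ∩ D, y r + ∑ r ∈ D \ U, y r := by
    rw [Finset.inter_comm, Finset.sum_inter_add_sum_sdiff]
  -- Outside `U` no coordinate of `D` has `x < y`, and `p` gives strictness.
  have h6 : ∑ r ∈ D \ U, y r < ∑ r ∈ D \ U, x r := by
    refine Finset.sum_lt_sum (fun r hr => ?_) ⟨p, by simp [hpD, hpU], hp⟩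
    by_contra hlt
    obtain ⟨hrD, hrU⟩ := Finset.mem_sdiff.1 hr
    exact hrU (hAU (Finset.mem_filter.2 ⟨hrD, not_le.1 hlt⟩))
  omega

/-- Integral base polyhedra satisfy the symmetric exchange property (they are M-convex). -/
theorem exists_exchange (hf : IsPolymatroidRank f) {d : ℕ} (hd : d ≤ f Finset.univ)
    {x y : R → ℕ} (hx : x ∈ basePolyhedron f d) (hy : y ∈ basePolyhedron f d)
    {p : R} (hp : y p < x p) :
    ∃ q, x q < y q ∧ exchange x p q ∈ basePolyhedron f d ∧
      exchange y q p ∈ basePolyhedron f d := by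
  rw [mem_basePolyhedron_min] at hx hy
  obtain ⟨q, hq, h1, h2⟩ := exists_exchange_aux (isPolymatroidRank_min hf d) hx.1 hy.1
    (by rw [hy.2, min_eq_right hd]) hp
  have hpq : p ≠ q := by rintro rfl; omega
  refine ⟨q, hq, mem_basePolyhedron_min.2 ⟨h1, ?_⟩, mem_basePolyhedron_min.2 ⟨h2, ?_⟩⟩
  · rw [sum_univ_exchange x hpq (by omega), hx.2]
  · rw [sum_univ_exchange y hpq.symm (by omega), hy.2]

/-- If every resource were blocked, the blocking tight sets would unite to the full set, forcing `d
= f univ`. -/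
theorem exists_add_unit_mem (hf : IsPolymatroidRank f) {d : ℕ} (hd : d < f Finset.univ)
    {x : R → ℕ} (hx : x ∈ basePolyhedron f d) :
    ∃ s, Function.update x s (x s + 1) ∈ basePolyhedron f (d + 1) := by
  have hsum : ∀ s (U : Finset R), ∑ r ∈ U, Function.update x s (x s + 1) r =
      ∑ r ∈ U, x r + if s ∈ U then 1 else 0 := by
    intro s U
    have : ∀ r, Function.update x s (x s + 1) r = x r + if r = s then 1 else 0 := by
      intro r
      by_cases h : r = s
      · subst h; simp
      · simp [h]
    simp [this, Finset.sum_add_distrib]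
  by_contra! hcon
  obtain ⟨U, hU, -, ht⟩ := exists_tight_superset hf hx.1 (fun _ => True) trivial
    (fun _ _ _ _ => trivial) Finset.univ (by
      intro s _
      by_contra! hno
      refine hcon s ⟨fun U => ?_, by rw [hsum, hx.2]; simp⟩
      rw [hsum]
      have h1 := hx.1 U
      have h2 := hno U
      split_ifs with h
      · have := h2 h trivial
        omega
      · omega)
  rw [Finset.univ_subset_iff.1 hU, hx.2] at ht
  omega

end Polyhedron

/-! ### Stability under unit moves -/

section Stability

variable {R : Type*} [DecidableEq R] [Fintype R]

/-- The marginal costs `m r L k` (of the `k`-th unit on `r` at total load `L`) are monotone, as long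
as `k` is at most the capacity `u r`. -/
def MonotoneMarginals (u : R → ℕ) (m : R → ℕ → ℕ → ℝ) : Prop :=
  ∀ r L L' k k', L ≤ L' → 1 ≤ k → k ≤ k' → k' ≤ u r → m r L k ≤ m r L' k'

/-- At total load `l`, no feasible move of one unit is profitable. -/
def ExchangeStable (f : Finset R → ℕ) (d : ℕ) (m : R → ℕ → ℕ → ℝ) (l x : R → ℕ) : Prop :=
  ∀ p q, p ≠ q → 1 ≤ x p → exchange x p q ∈ basePolyhedron f d →
    m p (l p) (x p) ≤ m q (l q + 1) (x q + 1)

variable {f : Finset R → ℕ} {d : ℕ} {m : R → ℕ → ℕ → ℝ} {l x : R → ℕ}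

theorem succ_le_rank_of_exchange_mem {p q : R} (h : exchange x p q ∈ basePolyhedron f d) :
    x q + 1 ≤ f {q} := by
  simpa [exchange] using apply_le_rank_singleton h.1 q

/-- A further move `p → q` yields `y = x - r + s - p + q`. When moves cancel, `hmin`, `hlt` or the
stability of `x` suffices. Otherwise symmetric exchange between `x` and `y` splits the double move
into feasible single moves from `x`. -/
theorem ExchangeStable.exchange (hf : IsPolymatroidRank f) (hd : d ≤ f Finset.univ)
    (hm : MonotoneMarginals (fun r => f {r}) m) (hx : x ∈ basePolyhedron f d)
    (hst : ExchangeStable f d m l x) {r s : R} (hrs : r ≠ s) (hr : 1 ≤ x r)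
    (hs : exchange x r s ∈ basePolyhedron f d)
    (hmin : ∀ q, r ≠ q → PolymatroidCongestionGame.exchange x r q ∈ basePolyhedron f d →
      m s (l s + 1) (x s + 1) ≤ m q (l q + 1) (x q + 1))
    (hlt : m s (l s + 1) (x s + 1) < m r (l r + 1) (x r)) :
    ExchangeStable f d m l (PolymatroidCongestionGame.exchange x r s) := by
  intro p q hpq hp hy
  have hxs := succ_le_rank_of_exchange_mem hs
  have hyq := succ_le_rank_of_exchange_mem hy
  have hxp := apply_le_rank_singleton hx.1 p
  set x' := PolymatroidCongestionGame.exchange x r s with hx'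
  set y := PolymatroidCongestionGame.exchange x' p q with hy'
  have hx's : x' s = x s + 1 := by simp [hx', PolymatroidCongestionGame.exchange]
  have hx'r : x' r + 1 = x r := by
    simp [hx', PolymatroidCongestionGame.exchange, hrs]; omega
  have hx'o : ∀ t, t ≠ r → t ≠ s → x' t = x t := by
    intro t h1 h2
    simp [hx', PolymatroidCongestionGame.exchange, h1, h2]
  have hx'le : ∀ t, t ≠ s → x' t ≤ x t := by
    intro t h
    by_cases h1 : t = r
    · subst h1; omega
    · exact (hx'o t h1 h).le
  have hx'ge : ∀ t, t ≠ r → x t ≤ x' t := by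
    intro t h
    by_cases h1 : t = s
    · subst h1; omega
    · exact (hx'o t h h1).ge
  have hyv : ∀ t, y t + (if t = p then 1 else 0) + (if t = r then 1 else 0) =
      x t + (if t = q then 1 else 0) + (if t = s then 1 else 0) := by
    intro t
    have h1 : y t + (if t = p then 1 else 0) = x' t + (if t = q then 1 else 0) := by
      simp only [hy', PolymatroidCongestionGame.exchange]; grind
    have h2 : x' t + (if t = r then 1 else 0) = x t + (if t = s then 1 else 0) := by
      simp only [hx', PolymatroidCongestionGame.exchange]; grind
    omega
  have hmem : ∀ (a b : R), a ≠ b → 1 ≤ x a →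
      (∀ t, y t + (if t = a then 1 else 0)
        = x t + (if t = b then 1 else 0)) →
      PolymatroidCongestionGame.exchange x a b = y := by
    intro a b hab ha h
    funext t
    have := h t
    simp only [PolymatroidCongestionGame.exchange]
    grind
  by_cases hps : p = s
  · subst hps
    rw [hx's]
    refine (hm p _ (l p + 1) _ (x p + 1) (by omega) (by omega) le_rfl hxs).trans ?_
    by_cases hqr : q = r
    · subst hqr
      rw [hx'r]
      exact hlt.le
    · have h : PolymatroidCongestionGame.exchange x r q = y :=
        hmem r q (Ne.symm hqr) hr fun t => by have := hyv t; split_ifs at this ⊢ <;> omega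
      have := hmin q (Ne.symm hqr) (h ▸ hy)
      rwa [hx'o q hqr (Ne.symm hpq)]
  · have hxp1 : 1 ≤ x p := hp.trans (hx'le p hps)
    have hu : m p (l p) (x' p) ≤ m p (l p) (x p) := hm p _ _ _ _ le_rfl hp (hx'le p hps) hxp
    refine hu.trans ?_
    by_cases hqr : q = r
    · subst hqr
      have h : PolymatroidCongestionGame.exchange x p s = y :=
        hmem p s hps hxp1 fun t => by have := hyv t; split_ifs at this ⊢ <;> omega
      rw [hx'r]
      exact (hst p s hps hxp1 (h ▸ hy)).trans hlt.le
    · have hw : m q (l q + 1) (x q + 1) ≤ m q (l q + 1) (x' q + 1) :=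
        hm q _ _ _ _ le_rfl (by omega) (by have := hx'ge q hqr; omega) hyq
      refine le_trans ?_ hw
      have hyp : y p < x p := by
        have := hyv p
        simp only [if_true, hpq, hps, if_false] at this
        omega
      -- Only `q` and `s` can gain from `x` to `y`. If `t = s`, then `y - s + p = x - r + q`, so `s`
      -- is at most as expensive as `q` by `hmin`.
      obtain ⟨t, ht, h1, h2⟩ := exists_exchange hf hd hx hy hyp
      have htqs : t = q ∨ t = s := by
        by_contra! hne
        have := hyv t
        simp only [hne.1, hne.2, if_false] at this
        omega
      by_cases htq : t = q
      · exact hst p q hpq hxp1 (htq ▸ h1)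
      · obtain rfl : t = s := htqs.resolve_left htq
        refine (hst p t hps hxp1 h1).trans (hmin q (Ne.symm hqr) ?_)
        convert h2 using 1
        funext v
        have := hyv v
        simp only [PolymatroidCongestionGame.exchange]
        grind

theorem ExchangeStable.add_unit (hm : MonotoneMarginals (fun r => f {r}) m)
    (hst : ExchangeStable f d m l x) {s : R}
    (hs : Function.update x s (x s + 1) ∈ basePolyhedron f (d + 1))
    (hmin : ∀ q, Function.update x q (x q + 1) ∈ basePolyhedron f (d + 1) →
      m s (l s + 1) (x s + 1) ≤ m q (l q + 1) (x q + 1)) :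
    ExchangeStable f (d + 1) m l (Function.update x s (x s + 1)) := by
  intro p q hpq hp hy
  have hxs : x s + 1 ≤ f {s} := by simpa using apply_le_rank_singleton hs.1 s
  have hyq := succ_le_rank_of_exchange_mem hy
  by_cases hps : p = s
  · subst hps
    have h : PolymatroidCongestionGame.exchange (Function.update x p (x p + 1)) p q =
        Function.update x q (x q + 1) := by
      funext t
      simp only [PolymatroidCongestionGame.exchange, Function.update_apply]
      grind
    rw [h] at hy
    rw [Function.update_self, Function.update_of_ne hpq.symm]
    exact (hm p _ (l p + 1) _ _ (by omega) (by omega) le_rfl hxs).trans (hmin q hy)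
  · rw [Function.update_of_ne hps] at hp ⊢
    have hle : x q ≤ Function.update x s (x s + 1) q := by
      simp only [Function.update_apply]; grind
    -- The same move from `x` is feasible because its result lies below the one with the extra unit.
    refine (hst p q hpq hp ⟨mem_integralPolyhedron_of_le hy.1 fun t => ?_, ?_⟩).trans
      (hm q _ _ _ _ le_rfl (by omega) (by omega) hyq)
    · simp only [PolymatroidCongestionGame.exchange, Function.update_apply]
      grind
    · rw [sum_univ_exchange x hpq hp]
      have h1 := hs.2
      rw [Finset.sum_update_of_mem (Finset.mem_univ s)] at h1
      rw [Finset.sdiff_singleton_eq_erase] at h1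
      have h2 := Finset.add_sum_erase _ x (Finset.mem_univ s)
      omega

/-- For separable objectives that are convex up to the capacities, local optimality implies
global optimality. -/
theorem sum_le_sum_of_exchange (hf : IsPolymatroidRank f) (hd : d ≤ f Finset.univ)
    (F : R → ℕ → ℝ)
    (hF : ∀ r j k, 1 ≤ j → j ≤ k → k ≤ f {r} → F r j - F r (j - 1) ≤ F r k - F r (k - 1))
    (hx : x ∈ basePolyhedron f d)
    (hopt : ∀ p q, p ≠ q → 1 ≤ x p → exchange x p q ∈ basePolyhedron f d →
      F p (x p) - F p (x p - 1) ≤ F q (x q + 1) - F q (x q)) :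
    ∀ {y : R → ℕ}, y ∈ basePolyhedron f d → ∑ r, F r (x r) ≤ ∑ r, F r (y r) := by
  suffices h : ∀ n, ∀ y ∈ basePolyhedron f d, ∑ r, (x r - y r) = n →
      ∑ r, F r (x r) ≤ ∑ r, F r (y r) from fun {y} hy => h _ y hy rfl
  intro n
  induction n using Nat.strong_induction_on with
  | _ n ih =>
  intro y hy hn
  by_cases hxy : ∃ p, y p < x p
  · obtain ⟨p, hp⟩ := hxy
    -- Moving `y` one unit towards `x` does not raise the objective: convexity compares its
    -- increments with those at `x`.
    obtain ⟨q, hq, h1, h2⟩ := exists_exchange hf hd hx hy hp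
    have hpq : p ≠ q := by rintro rfl; omega
    have h3 : ∑ r, (x r - exchange y q p r) < n := by
      rw [← hn]
      refine Finset.sum_lt_sum (fun r _ => ?_) ⟨p, Finset.mem_univ p, ?_⟩
      · simp only [exchange]; grind
      · simp only [exchange]; grind
    refine (ih _ h3 _ h2 rfl).trans ?_
    rw [sum_exchange F y hpq.symm]
    have h4 := hopt p q hpq (by omega) h1
    have h5 := hF p (y p + 1) (x p) (by omega) hp (apply_le_rank_singleton hx.1 p)
    have h6 := hF q (x q + 1) (y q) (by omega) hq (apply_le_rank_singleton hy.1 q)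
    simp only [Nat.add_sub_cancel] at h5 h6
    linarith
  · push Not at hxy
    have h : ∀ r ∈ Finset.univ, x r = y r :=
      (Finset.sum_eq_sum_iff_of_le fun r _ => hxy r).1 (hx.2.trans hy.2.symm)
    exact (Finset.sum_congr rfl fun r hr => by rw [h r hr]).le

end Stability

/-! ### Existence of a stable profile -/

section Equilibrium

theorem load_update {N R : Type*} [Fintype N] [DecidableEq N] (x : N → R → ℕ) (i : N) (z : R → ℕ) (r : R) :
    load (Function.update x i z) r + x i r = load x r + z r := by
  have h1 : load x r = x i r + ∑ j ∈ Finset.univ.erase i, x j r :=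
    (Finset.add_sum_erase _ (fun j => x j r) (Finset.mem_univ i)).symm
  have h2 : load (Function.update x i z) r = z r + ∑ j ∈ Finset.univ.erase i, x j r := by
    unfold load
    rw [← Finset.add_sum_erase _ _ (Finset.mem_univ i), Function.update_self]
    congr 1
    refine Finset.sum_congr rfl fun j hj => ?_
    rw [Function.update_of_ne (Finset.ne_of_mem_erase hj)]
  omega

variable {N R : Type*} [Fintype N] [DecidableEq N] [Fintype R] [DecidableEq R]

theorem finite_setOf_mem_basePolyhedron (f : N → Finset R → ℕ) (d : N → ℕ) :
    {x : N → R → ℕ | ∀ i, x i ∈ basePolyhedron (f i) (d i)}.Finite := by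
  refine (Set.finite_Iic fun i _ => d i).subset fun x hx i r => ?_
  change x i r ≤ d i
  rw [← (hx i).2]
  exact Finset.single_le_sum (fun _ _ => Nat.zero_le _) (Finset.mem_univ r)

variable {f : N → Finset R → ℕ} {m : N → R → ℕ → ℕ → ℝ}

/-- The players react to one extra unit on a resource by moving single units; this process
terminates in a stable profile. -/
theorem exists_stable_of_extra_unit (hf : ∀ i, IsPolymatroidRank (f i))
    (hm : ∀ i, MonotoneMarginals (fun r => f i {r}) (m i)) {d : N → ℕ}
    (hd : ∀ i, d i ≤ f i Finset.univ) {l : R → ℕ}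
    (h : ∃ x : N → R → ℕ, ∃ t, (∀ i, x i ∈ basePolyhedron (f i) (d i)) ∧
      (∀ r, load x r = l r + if r = t then 1 else 0) ∧
      ∀ i, ExchangeStable (f i) (d i) (m i) l (x i)) :
    ∃ x : N → R → ℕ, (∀ i, x i ∈ basePolyhedron (f i) (d i)) ∧
      ∀ i, ExchangeStable (f i) (d i) (m i) (load x) (x i) := by
  have hfin : {x : N → R → ℕ | ∃ t, (∀ i, x i ∈ basePolyhedron (f i) (d i)) ∧
      (∀ r, load x r = l r + if r = t then 1 else 0) ∧
      ∀ i, ExchangeStable (f i) (d i) (m i) l (x i)}.Finite :=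
    (finite_setOf_mem_basePolyhedron f d).subset fun x ⟨_, hx, _⟩ => hx
  -- The load is frozen at `l r + 1`: the load at the resource the excess unit leaves, and at the
  -- one it reaches.
  let F : N → R → ℕ → ℝ := fun i r n => ∑ k ∈ Finset.range n, m i r (l r + 1) (k + 1)
  obtain ⟨x, ⟨t, hx, hl, hst⟩, hpot⟩ :=
    Set.exists_min_image _ (fun x : N → R → ℕ => ∑ i, ∑ r, F i r (x i r)) hfin h
  refine ⟨x, hx, ?_⟩
  by_contra! hcon
  obtain ⟨i, hi⟩ := hcon
  unfold ExchangeStable at hi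
  push Not at hi
  obtain ⟨p, q, hpq, hp, hmem, hlt⟩ := hi
  have hqb := succ_le_rank_of_exchange_mem hmem
  -- Away from `t` the load at `p` is still `l p`, and the load at `q` is at least `l q`, so
  -- stability at `l` already excludes the move.
  obtain rfl : p = t := by
    by_contra hpt
    have h1 := hst i p q hpq hp hmem
    have h2 := hm i q (l q + 1) (load x q + 1) _ _ (by rw [hl q]; omega) (by omega) le_rfl hqb
    rw [hl p, if_neg hpt, add_zero] at hlt
    linarith
  rw [hl p, hl q, if_pos rfl, if_neg hpq.symm, add_zero] at hlt
  obtain ⟨s, ⟨hps, hs⟩, hmin⟩ := Set.exists_min_image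
    {s | p ≠ s ∧ exchange (x i) p s ∈ basePolyhedron (f i) (d i)}
    (fun s => m i s (l s + 1) (x i s + 1)) (Set.toFinite _) ⟨q, hpq, hmem⟩
  have hlt' := (hmin q ⟨hpq, hmem⟩).trans_lt hlt
  have hnew : ∑ j, ∑ r, F j r (x j r) ≤
      ∑ j, ∑ r, F j r (Function.update x i (exchange (x i) p s) j r) := by
    refine hpot _ ⟨s, fun j => ?_, fun r => ?_, fun j => ?_⟩
    · by_cases hj : j = i
      · subst hj
        rwa [Function.update_self]
      · rw [Function.update_of_ne hj]
        exact hx j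
    · have h1 := load_update x i (exchange (x i) p s) r
      have h2 := hl r
      simp only [exchange] at h1 ⊢
      grind
    · by_cases hj : j = i
      · subst hj
        rw [Function.update_self]
        exact (hst j).exchange (hf j) (hd j) (hm j) (hx j) hps hp hs
          (fun q h1 h2 => hmin q ⟨h1, h2⟩) hlt'
      · rw [Function.update_of_ne hj]
        exact hst j
  rw [← Finset.add_sum_erase _ _ (Finset.mem_univ i),
    ← Finset.add_sum_erase _ _ (Finset.mem_univ i), Function.update_self] at hnew
  have herase : ∑ j ∈ Finset.univ.erase i,
      ∑ r, F j r (Function.update x i (exchange (x i) p s) j r) =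
      ∑ j ∈ Finset.univ.erase i, ∑ r, F j r (x j r) :=
    Finset.sum_congr rfl fun j hj => by rw [Function.update_of_ne (Finset.ne_of_mem_erase hj)]
  rw [herase, sum_exchange (F i) (x i) hps] at hnew
  have h1 : F i s (x i s + 1) - F i s (x i s) = m i s (l s + 1) (x i s + 1) := by
    simp [F, Finset.sum_range_succ]
  have h2 : F i p (x i p) - F i p (x i p - 1) = m i p (l p + 1) (x i p) := by
    obtain ⟨k, hk⟩ : ∃ k, x i p = k + 1 := ⟨x i p - 1, by omega⟩
    simp [F, hk, Finset.sum_range_succ]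
  linarith

theorem exists_stable_profile (hf : ∀ i, IsPolymatroidRank (f i))
    (hm : ∀ i, MonotoneMarginals (fun r => f i {r}) (m i)) (n : ℕ) :
    ∀ d : N → ℕ, (∀ i, d i ≤ f i Finset.univ) → ∑ i, d i = n →
      ∃ x : N → R → ℕ, (∀ i, x i ∈ basePolyhedron (f i) (d i)) ∧
        ∀ i, ExchangeStable (f i) (d i) (m i) (load x) (x i) := by
  induction n with
  | zero =>
    intro d _ hsum
    have hd0 : ∀ i, d i = 0 := fun i => Finset.sum_eq_zero_iff.1 hsum i (Finset.mem_univ i)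
    refine ⟨fun _ _ => 0, fun i => ⟨fun U => by simp, by simp [hd0 i]⟩, fun i p q _ hp => ?_⟩
    simp at hp
  | succ n ih =>
    intro d hd hsum
    obtain ⟨i, -, hi⟩ : ∃ i ∈ Finset.univ, d i ≠ 0 :=
      Finset.exists_ne_zero_of_sum_ne_zero (by omega)
    obtain ⟨e, he⟩ : ∃ e, d i = e + 1 := ⟨d i - 1, by omega⟩
    have hsum' : ∑ j, Function.update d i e j = n := by
      have h1 := Finset.add_sum_erase _ d (Finset.mem_univ i)
      have h2 := Finset.sum_update_of_mem (Finset.mem_univ i) d e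
      rw [Finset.sdiff_singleton_eq_erase] at h2
      omega
    obtain ⟨x, hx, hst⟩ := ih (Function.update d i e) (fun j => by
      have := hd j
      simp only [Function.update_apply]
      grind) hsum'
    have hxi := hx i
    have hsti := hst i
    rw [Function.update_self] at hxi hsti
    obtain ⟨s, hs, hmin⟩ := Set.exists_min_image
      {s | Function.update (x i) s (x i s + 1) ∈ basePolyhedron (f i) (e + 1)}
      (fun s => m i s (load x s + 1) (x i s + 1)) (Set.toFinite _)
      (exists_add_unit_mem (hf i) (by have := hd i; omega) hxi)
    -- The reference load stays that of the smaller profile; `s` carries the extra unit.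
    refine exists_stable_of_extra_unit hf hm hd (l := load x)
      ⟨Function.update x i (Function.update (x i) s (x i s + 1)), s, fun j => ?_, fun r => ?_,
        fun j => ?_⟩
    · by_cases hj : j = i
      · subst hj
        rw [Function.update_self, he]
        exact hs
      · rw [Function.update_of_ne hj]
        simpa [hj] using hx j
    · have h1 := load_update x i (Function.update (x i) s (x i s + 1)) r
      simp only [Function.update_apply (x i)] at h1
      split_ifs at h1 ⊢ with h
      · subst h; omega
      · omega
    · by_cases hj : j = i
      · subst hj
        rw [Function.update_self, he]
        exact hsti.add_unit (hm j) hs hmin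
      · rw [Function.update_of_ne hj]
        simpa [hj] using hst j

end Equilibrium

/-! ### Marginal costs and best responses -/

/-- The cost increase caused by the `k`-th own unit if the total load is `L` afterwards. If
`L < k`, then `L` is replaced by `k`. -/
noncomputable def marginalCost (c : ℕ → ℝ) (L k : ℕ) : ℝ :=
  c (L - k + k) * (k : ℝ) - c (L - k + k - 1) * ((k : ℝ) - 1)

/-- Semi-convexity with equal own amounts gives monotonicity in the load. At a fixed load above `k`,
raising `k` by one adds `c L' - c (L' - 1)`, nonnegative as `c` is monotone. -/
theorem marginalCost_mono {u : ℕ} {c : ℕ → ℝ} (hc : Monotone c)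
    (hs : TruncatedStronglySemiConvex u c) {L L' k k' : ℕ} (hL : L ≤ L') (hk : 1 ≤ k)
    (hkk' : k ≤ k') (hk' : k' ≤ u) : marginalCost c L k ≤ marginalCost c L' k' := by
  have hown : ∀ k, 1 ≤ k → k + 1 ≤ u → marginalCost c L' k ≤ marginalCost c L' (k + 1) := by
    intro k hk hku
    rcases le_or_gt L' k with h | h
    -- Here both truncated differences `L' - k` and `L' - (k + 1)` are zero.
    · exact hs k (k + 1) _ _ hk (by omega) hku (by omega)
    · unfold marginalCost
      rw [Nat.sub_add_cancel h.le, Nat.sub_add_cancel h]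
      have := hc (Nat.sub_le L' 1)
      push_cast
      linarith
  refine le_trans (hs k k _ _ hk le_rfl (hkk'.trans hk') (Nat.sub_le_sub_right hL k)) ?_
  change marginalCost c L' k ≤ _
  induction k', hkk' using Nat.le_induction with
  | base => exact le_rfl
  | succ j hj ih => exact (ih (by omega)).trans (hown j (by omega) hk')

variable {N R : Type*} [Fintype N] [DecidableEq N] [Fintype R] [DecidableEq R]

theorem privateCost_update (G : PolymatroidCongestionGame N R) (i : N) (x : N → R → ℕ)
    (z : R → ℕ) :
    G.privateCost i (Function.update x i z) =
      ∑ r, G.cost i r (load x r - x i r + z r) * (z r : ℝ) := by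
  refine Finset.sum_congr rfl fun r _ => ?_
  have h1 := load_update x i z r
  have h2 : x i r ≤ load x r :=
    Finset.single_le_sum (f := fun j => x j r) (fun _ _ => Nat.zero_le _) (Finset.mem_univ i)
  rw [Function.update_self, show load (Function.update x i z) r = load x r - x i r + z r by omega]

theorem isBestResponse_of_exchangeStable (G : PolymatroidCongestionGame N R) {i : N}
    {x : N → R → ℕ} (hssc : ∀ r, TruncatedStronglySemiConvex (G.rank i {r}) (G.cost i r))
    (hx : x i ∈ G.strategies i)
    (hst : ExchangeStable (G.rank i) (G.demand i) (fun r => marginalCost (G.cost i r))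
      (load x) (x i)) :
    G.IsBestResponse i x (x i) := by
  refine ⟨hx, fun y hy => ?_⟩
  rw [privateCost_update, privateCost_update]
  have hload : ∀ r, x i r ≤ load x r := fun r =>
    Finset.single_le_sum (f := fun j => x j r) (fun _ _ => Nat.zero_le _) (Finset.mem_univ i)
  have hdiff : ∀ r k, 1 ≤ k →
      G.cost i r (load x r - x i r + k) * (k : ℝ)
        - G.cost i r (load x r - x i r + (k - 1)) * ((k - 1 : ℕ) : ℝ) =
      G.cost i r (load x r - x i r + k) * (k : ℝ)
        - G.cost i r (load x r - x i r + k - 1) * ((k : ℝ) - 1) := by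
    intro r k hk
    rw [Nat.add_sub_assoc hk, Nat.cast_sub hk, Nat.cast_one]
  refine sum_le_sum_of_exchange (G.isPolymatroidRank i) (G.demand_le i)
    (fun r k => G.cost i r (load x r - x i r + k) * (k : ℝ)) ?_ hx ?_ hy
  · intro r j k hj hjk hk
    simp only [hdiff r j hj, hdiff r k (hj.trans hjk)]
    exact hssc r j k _ _ hj hjk hk le_rfl
  · intro p q hpq hp hmem
    have h := hst p q hpq hp hmem
    have hq := hdiff q (x i q + 1) (by omega)
    simp only [Nat.add_sub_cancel] at hq
    simp only [hdiff p _ hp, hq]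
    simpa [marginalCost] using h

end PolymatroidCongestionGame

theorem mainTheorem1 {N R : Type*} [Fintype N] [DecidableEq N] [Fintype R] [DecidableEq R]
    (G : PolymatroidCongestionGame N R)
    (hnonneg : ∀ (i : N) (r : R) (k : ℕ), 0 ≤ G.cost i r k)
    (hmono : ∀ (i : N) (r : R), Monotone (G.cost i r))
    (hssc : ∀ (i : N) (r : R), TruncatedStronglySemiConvex (G.rank i {r}) (G.cost i r)) :
    ∃ x : N → R → ℕ, G.IsPureNashEquilibrium x := by
  obtain ⟨x, hx, hst⟩ := PolymatroidCongestionGame.exists_stable_profile (f := G.rank)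
    (m := fun i r => PolymatroidCongestionGame.marginalCost (G.cost i r)) G.isPolymatroidRank
    (fun i r _ _ _ _ hL hk hkk' hk' =>
      PolymatroidCongestionGame.marginalCost_mono (hmono i r) (hssc i r) hL hk hkk' hk')
    _ G.demand G.demand_le rfl
  exact ⟨x, hx, fun i => G.isBestResponse_of_exchangeStable (hssc i) (hx i) (hst i)⟩
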